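/- Let $N\ge K\ge 1$ and $t\in\{0,1,\dots,K-1\}$ be integers. Consider the $K$-user cache-aided shared-link broadcast channel: a transmitter has a library of $N$ files of $f$ bits each, every user has a cache of size $Mf$ bits that is filled from the library before the requests are known, and afterwards every user requests one file and all users receive, without error, the same signal, at a rate of one file ($f$ bits) per unit of time. A delay $T$ is achievable if for every $\varepsilon>0$ and all sufficiently large $f$ there is a caching and delivery scheme whose delivery phase lasts at most $T+\varepsilon$ units of time for every request, and in which, for independent uniformly distributed files, under every request every user fails to recover its requested file with probability at most $\varepsilon$; it is achievable with zero error if the schemes can be chosen such that no user ever fails. Let $T^*$ be the infimum of all achievable delays. Put $\gamma=M/N$ and assume that $K\gamma\in[t,t+1]$. Then $$T''(K)=\big((t+1)-K\gamma\big)\frac{K-t}{t+1}+(K\gamma-t)\frac{K-(t+1)}{t+2}=\frac{K-t}{t+1}-\frac{(K\gamma-t)(K+1)}{(t+1)(t+2)}$$ is achievable, even with zero error, and $T''(K)\le 4\,T^*$. If moreover $\gamma<1$, then $T^*>0$ and $\frac{T''(K)}{T^*}<4$. -/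

import Mathlib

namespace CodedCaching

/-- A library of `N` files, each consisting of `F` bits. -/
abbrev Library (N F : ℕ) : Type := Fin N → Fin F → Bool

/-- A request: user `k` asks for the file with index `d k`. -/
abbrev Demand (K N : ℕ) : Type := Fin K → Fin N

/-- A caching scheme for the `K`-user broadcast channel in which all users observe, without error,
the same transmitted bit string (all links have the same capacity), with `N` files of `F` bits.
The caches are filled before the request is known, from the library alone. The transmitted signal
depends on the request and on the library. Each user sees the signal and its own cache only (and
knows the request). -/
structure Scheme (K N F : ℕ) where
  /-- number of bits stored in each cache -/
  cacheBits : ℕ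
  /-- number of bits transmitted in the delivery phase (the same for every request) -/
  sentBits : ℕ
  /-- the content of the cache of each user -/
  cache : Fin K → Library N F → (Fin cacheBits → Bool)
  /-- the transmitted signal -/
  send : Demand K N → Library N F → (Fin sentBits → Bool)
  /-- the file that user `k` reconstructs from the signal and its cache -/
  decode : Demand K N → Fin K → (Fin sentBits → Bool) → (Fin cacheBits → Bool) → (Fin F → Bool)

namespace Scheme

variable {K N F : ℕ}

/-- The reconstruction of the requested file by user `k`, for request `d` and library `W`. -/
def output (S : Scheme K N F) (d : Demand K N) (k : Fin K) (W : Library N F) : Fin F → Bool :=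
  S.decode d k (S.send d W) (S.cache k W)

/-- The probability that user `k` does not recover the requested file, under request `d`, when the
files are independent and uniformly distributed bit strings. -/
noncomputable def errorProb (S : Scheme K N F) (d : Demand K N) (k : Fin K) : ℝ :=
  ((Finset.univ.filter fun W : Library N F => S.output d k W ≠ W (d k)).card : ℝ) /
    (Fintype.card (Library N F) : ℝ)

/-- The duration of the delivery phase. The link carries one file (`F` bits) per unit of time. -/
noncomputable def delay (S : Scheme K N F) : ℝ := (S.sentBits : ℝ) / (F : ℝ)

/-- Every cache fits into the size of `M` files. -/
def FitsCache (S : Scheme K N F) (M : ℝ) : Prop := (S.cacheBits : ℝ) ≤ M * (F : ℝ)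

end Scheme

/-- The delay `T` is achievable with `K` users, `N` files and caches of the size of `M` files:
for every `ε > 0` and every large enough file size there is a scheme of delay at most `T + ε`
in which, for every request, every user fails with probability at most `ε`. -/
def Achievable (K N : ℕ) (M T : ℝ) : Prop :=
  ∀ ε : ℝ, 0 < ε → ∀ᶠ F : ℕ in Filter.atTop, ∃ S : Scheme K N F,
    S.FitsCache M ∧ S.delay ≤ T + ε ∧ ∀ d k, S.errorProb d k ≤ ε

/-- The same with schemes that never fail: every user recovers its file, whatever the request and
the content of the library. -/
def ZeroErrorAchievable (K N : ℕ) (M T : ℝ) : Prop :=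
  ∀ ε : ℝ, 0 < ε → ∀ᶠ F : ℕ in Filter.atTop, ∃ S : Scheme K N F,
    S.FitsCache M ∧ S.delay ≤ T + ε ∧ ∀ d k W, S.output d k W = W (d k)

/-- The optimal delay, over all schemes (with vanishing probability of error). -/
noncomputable def optimalDelay (K N : ℕ) (M : ℝ) : ℝ := sInf {T : ℝ | Achievable K N M T}

/-- The delay `T''(K)`: the linear interpolation in `K γ`, between the integers `t` and `t + 1`, of
the delays `(K - t) / (t + 1)` and `(K - (t + 1)) / (t + 2)`. -/
noncomputable def sharedDelay (K t : ℕ) (γ : ℝ) : ℝ :=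
  (((t : ℝ) + 1) - (K : ℝ) * γ) * (((K : ℝ) - (t : ℝ)) / ((t : ℝ) + 1)) +
    ((K : ℝ) * γ - (t : ℝ)) * (((K : ℝ) - ((t : ℝ) + 1)) / ((t : ℝ) + 2))

end CodedCaching

/-! Random variables on the uniformly distributed library are represented by the partitions of the
library that they induce: `⊓` is joint observation, and `partitionEntropy` is Shannon entropy.

Lower bound. One signal serves the first `s` users. Reveal their caches in turn: the signal and
cache `i` determine file `d i` up to a correction of small entropy, so by the chain rule
(`sum_cond_le_partitionEntropy`) the entropy of the signal is at least the sum of the conditional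
entropies of the requested files, up to the corrections. The request is built greedily. Before user
`i` chooses, `i + 1` caches and at most `i` files are known, so the files not yet requested lose at
most `i + 1` cache sizes of entropy in total; some file loses at most its share `(i + 1) * M / (N -
i)`, in units of a file (`exists_demand_cond_entropy_ge`). Hence `Achievable.lower_bound`.

Upper bound. `exactScheme_multicast` attains the two integer points `t` and `t + 1` of `K * γ`.
Splitting every file between the two schemes interpolates linearly.

Comparison. With `s = 1` the lower bound is `1 - γ`, which suffices when `K < 4 * (t + 1)`.
Otherwise `s = K / (2 * (t + 1))` works: both sides are then affine in `K * γ`, so only the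
endpoints `t` and `t + 1` need checking. -/

namespace CodedCaching

/-! ### Entropy of partitions of a finite uniform probability space. -/

section PartitionEntropy

variable {Ω : Type*} [Fintype Ω]

open Classical in
/-- The number of points in the class of `ω`. -/
noncomputable def classCard (r : Setoid Ω) (ω : Ω) : ℕ :=
  (Finset.univ.filter fun x => r ω x).card

theorem classCard_pos (r : Setoid Ω) (ω : Ω) : 0 < classCard r ω :=
  Finset.card_pos.mpr ⟨ω, by simp⟩

theorem classCard_mono {r s : Setoid Ω} (h : r ≤ s) (ω : Ω) : classCard r ω ≤ classCard s ω := by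
  classical
  refine Finset.card_le_card fun x hx => ?_
  simp only [Finset.mem_filter, Finset.mem_univ, true_and] at hx ⊢
  exact h hx

theorem classCard_congr {r : Setoid Ω} {x y : Ω} (h : r x y) : classCard r x = classCard r y := by
  classical
  unfold classCard
  congr 1
  ext z
  simp only [Finset.mem_filter, Finset.mem_univ, true_and]
  exact ⟨fun hz => r.trans (r.symm h) hz, fun hz => r.trans h hz⟩

/-- The Shannon entropy (in nats) of the class of a uniformly distributed point of `Ω`. -/
noncomputable def partitionEntropy (r : Setoid Ω) : ℝ :=
  (∑ ω, (Real.log (Fintype.card Ω) - Real.log (classCard r ω))) / Fintype.card Ω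

theorem partitionEntropy_anti {r s : Setoid Ω} (h : r ≤ s) :
    partitionEntropy s ≤ partitionEntropy r := by
  unfold partitionEntropy
  gcongr with ω
  · exact_mod_cast classCard_pos r ω
  · exact classCard_mono h ω

theorem partitionEntropy_bot [Nonempty Ω] : partitionEntropy (⊥ : Setoid Ω) = Real.log (Fintype.card Ω) := by
  have h1 : ∀ ω : Ω, classCard (⊥ : Setoid Ω) ω = 1 := by
    intro ω
    classical
    rw [classCard, Finset.card_eq_one]
    exact ⟨ω, by ext x; simp [eq_comm]⟩
  have h : (Fintype.card Ω : ℝ) ≠ 0 := by exact_mod_cast Fintype.card_ne_zero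
  simp [partitionEntropy, h1]

theorem partitionEntropy_top : partitionEntropy (⊤ : Setoid Ω) = 0 := by
  have h1 : ∀ ω : Ω, classCard (⊤ : Setoid Ω) ω = Fintype.card Ω := by
    intro ω
    classical
    simp [classCard, Setoid.top_def, Finset.card_univ]
  simp [partitionEntropy, h1]

/-- The reciprocals of the class sizes add up to at most one over every class. -/
theorem sum_inv_classCard_le_one (r : Setoid Ω) (p : Ω → Prop) [DecidablePred p]
    (hp : ∀ x y, p x → p y → r x y) :
    ∑ ω ∈ Finset.univ.filter p, (classCard r ω : ℝ)⁻¹ ≤ 1 := by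
  rcases (Finset.univ.filter p).eq_empty_or_nonempty with h | ⟨a, ha⟩
  · simp [h]
  have ha' : p a := by simpa using ha
  have h1 : ∀ ω ∈ Finset.univ.filter p, (classCard r ω : ℝ)⁻¹ = (classCard r a : ℝ)⁻¹ := by
    intro ω hω
    rw [classCard_congr (hp ω a (by simpa using hω) ha')]
  rw [Finset.sum_congr rfl h1, Finset.sum_const, nsmul_eq_mul]
  have hpos : (0 : ℝ) < classCard r a := by exact_mod_cast classCard_pos r a
  rw [mul_inv_le_iff₀ hpos, one_mul]
  norm_cast
  refine Finset.card_le_card fun x hx => ?_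
  simp only [Finset.mem_filter, Finset.mem_univ, true_and] at hx ⊢
  exact hp a x ha' hx

variable [Nonempty Ω]

/-- Gibbs' inequality. -/
theorem partitionEntropy_ker_le {α : Type*} [Fintype α] (X : Ω → α) (q : α → ℝ)
    (hq : ∀ a, 0 < q a) (hsum : ∑ a, q a ≤ 1) :
    partitionEntropy (Setoid.ker X) ≤ (∑ ω, -Real.log (q (X ω))) / Fintype.card Ω := by
  classical
  obtain ⟨n, hn⟩ : ∃ n : ℝ, n = Fintype.card Ω := ⟨_, rfl⟩
  have hn0 : 0 < n := by rw [hn]; exact_mod_cast Fintype.card_pos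
  have hsum' : ∑ ω, q (X ω) * (classCard (Setoid.ker X) ω : ℝ)⁻¹ ≤ 1 := by
    calc ∑ ω, q (X ω) * (classCard (Setoid.ker X) ω : ℝ)⁻¹
        = ∑ a, ∑ ω ∈ Finset.univ.filter (fun ω => X ω = a),
            q (X ω) * (classCard (Setoid.ker X) ω : ℝ)⁻¹ :=
          (Finset.sum_fiberwise _ _ _).symm
      _ = ∑ a, q a * ∑ ω ∈ Finset.univ.filter (fun ω => X ω = a),
            (classCard (Setoid.ker X) ω : ℝ)⁻¹ := by
          refine Finset.sum_congr rfl fun a _ => ?_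
          rw [Finset.mul_sum]
          refine Finset.sum_congr rfl fun ω hω => ?_
          rw [(Finset.mem_filter.mp hω).2]
      _ ≤ ∑ a, q a * 1 := by
          gcongr with a
          · exact (hq a).le
          · exact sum_inv_classCard_le_one _ _ fun x y hx hy => hx.trans hy.symm
      _ ≤ 1 := by simpa using hsum
  unfold partitionEntropy
  rw [← hn]
  refine (div_le_div_iff_of_pos_right hn0).mpr ?_
  -- This is `log x ≤ x - 1` at the ratio `x` of `q` to the true probability of the value; by
  -- `hsum'` the error terms sum to at most zero.
  have hpt : ∀ ω, Real.log n - Real.log (classCard (Setoid.ker X) ω) ≤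
      -Real.log (q (X ω)) + (n * (q (X ω) * (classCard (Setoid.ker X) ω : ℝ)⁻¹) - 1) := by
    intro ω
    have hc : (0 : ℝ) < classCard (Setoid.ker X) ω := by exact_mod_cast classCard_pos _ ω
    have hx := hq (X ω)
    have := Real.log_le_sub_one_of_pos
      (show 0 < n * (q (X ω) * (classCard (Setoid.ker X) ω : ℝ)⁻¹) by positivity)
    rw [Real.log_mul (by positivity) (by positivity), Real.log_mul (by positivity) (by positivity),
      Real.log_inv] at this
    linarith
  calc _ ≤ ∑ ω, (-Real.log (q (X ω)) +
          (n * (q (X ω) * (classCard (Setoid.ker X) ω : ℝ)⁻¹) - 1)) :=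
        Finset.sum_le_sum fun ω _ => hpt ω
    _ = ∑ ω, -Real.log (q (X ω)) +
          (n * ∑ ω, q (X ω) * (classCard (Setoid.ker X) ω : ℝ)⁻¹ - n) := by
        rw [Finset.sum_add_distrib, Finset.sum_sub_distrib, ← Finset.mul_sum]
        simp [hn]
    _ ≤ _ := by nlinarith

theorem partitionEntropy_ker_le_log_card {α : Type*} [Fintype α] (X : Ω → α) :
    partitionEntropy (Setoid.ker X) ≤ Real.log (Fintype.card α) := by
  have : Nonempty α := ‹Nonempty Ω›.map X
  have hc : (0 : ℝ) < Fintype.card α := by exact_mod_cast Fintype.card_pos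
  have hn : (Fintype.card Ω : ℝ) ≠ 0 := by exact_mod_cast Fintype.card_ne_zero
  refine (partitionEntropy_ker_le X (fun _ => (Fintype.card α : ℝ)⁻¹) (fun _ => by positivity)
    ?_).trans_eq ?_
  · simp
  · simp

/-- Submodularity: nonnegativity of the conditional mutual information. -/
theorem partitionEntropy_submodular (r s t : Setoid Ω) :
    partitionEntropy (r ⊓ (s ⊓ t)) + partitionEntropy t ≤
      partitionEntropy (r ⊓ t) + partitionEntropy (s ⊓ t) := by
  classical
  have hn0 : (0 : ℝ) < Fintype.card Ω := by exact_mod_cast Fintype.card_pos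
  -- The product of class sizes counts pairs `(a, b)`. After exchanging the sums, the `ω` compatible
  -- with a fixed pair lie in one class of `r ⊓ (s ⊓ t)`, so their weights sum to at most one.
  have key : ∑ ω, ((classCard (r ⊓ t) ω : ℝ) * classCard (s ⊓ t) ω *
      (classCard (r ⊓ (s ⊓ t)) ω : ℝ)⁻¹ * (classCard t ω : ℝ)⁻¹) ≤ Fintype.card Ω := by
    have h1 : ∀ ω, ((classCard (r ⊓ t) ω : ℝ) * classCard (s ⊓ t) ω *
        (classCard (r ⊓ (s ⊓ t)) ω : ℝ)⁻¹ * (classCard t ω : ℝ)⁻¹) =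
        ∑ a, ∑ b, if (t a b ∧ (r ⊓ t) ω a ∧ (s ⊓ t) ω b) then
          (classCard (r ⊓ (s ⊓ t)) ω : ℝ)⁻¹ * (classCard t a : ℝ)⁻¹ else 0 := by
      intro ω
      have h2 : ∀ a b, (if (t a b ∧ (r ⊓ t) ω a ∧ (s ⊓ t) ω b) then
          (classCard (r ⊓ (s ⊓ t)) ω : ℝ)⁻¹ * (classCard t a : ℝ)⁻¹ else 0) =
          (if (r ⊓ t) ω a then (1 : ℝ) else 0) * (if (s ⊓ t) ω b then (1 : ℝ) else 0) *
          ((classCard (r ⊓ (s ⊓ t)) ω : ℝ)⁻¹ * (classCard t ω : ℝ)⁻¹) := by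
        intro a b
        by_cases ha : (r ⊓ t) ω a
        · by_cases hb : (s ⊓ t) ω b
          · have hta : t ω a := ha.2
            have hab : t a b := t.trans (t.symm hta) hb.2
            simp [ha, hb, hab, classCard_congr hta]
          · simp [hb]
        · simp [ha]
      simp_rw [h2, ← Finset.sum_mul, ← Finset.mul_sum, ← Finset.sum_mul]
      simp only [classCard, Finset.sum_boole]
      ring
    simp_rw [h1]
    rw [Finset.sum_comm]
    have hswap : ∀ f : Ω → Ω → Ω → ℝ, ∑ a, ∑ ω, ∑ b, f a ω b = ∑ a, ∑ b, ∑ ω, f a ω b :=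
      fun f => Finset.sum_congr rfl fun a _ => Finset.sum_comm
    rw [hswap]
    calc ∑ a, ∑ b, ∑ ω, (if (t a b ∧ (r ⊓ t) ω a ∧ (s ⊓ t) ω b) then
          (classCard (r ⊓ (s ⊓ t)) ω : ℝ)⁻¹ * (classCard t a : ℝ)⁻¹ else 0)
        ≤ ∑ a, ∑ b, if t a b then (classCard t a : ℝ)⁻¹ else 0 := by
          refine Finset.sum_le_sum fun a _ => Finset.sum_le_sum fun b _ => ?_
          by_cases hab : t a b
          · simp only [hab, true_and, if_true]
            rw [← Finset.sum_filter, ← Finset.sum_mul]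
            refine mul_le_of_le_one_left (by positivity) ?_
            refine sum_inv_classCard_le_one (r ⊓ (s ⊓ t))
              (fun ω => (r ⊓ t) ω a ∧ (s ⊓ t) ω b) ?_
            rintro x y ⟨hx1, hx2⟩ ⟨hy1, hy2⟩
            exact ⟨r.trans hx1.1 (r.symm hy1.1), s.trans hx2.1 (s.symm hy2.1),
              t.trans hx1.2 (t.symm hy1.2)⟩
          · simp [hab]
      _ = ∑ a : Ω, (1 : ℝ) := by
          refine Finset.sum_congr rfl fun a _ => ?_
          rw [← Finset.sum_filter, Finset.sum_const, nsmul_eq_mul]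
          have : (classCard t a : ℝ) ≠ 0 := by exact_mod_cast (classCard_pos t a).ne'
          exact mul_inv_cancel₀ this
      _ = _ := by simp
  have hpt : ∀ ω, Real.log (classCard (r ⊓ t) ω) + Real.log (classCard (s ⊓ t) ω) -
      Real.log (classCard (r ⊓ (s ⊓ t)) ω) - Real.log (classCard t ω) ≤
      (classCard (r ⊓ t) ω : ℝ) * classCard (s ⊓ t) ω *
      (classCard (r ⊓ (s ⊓ t)) ω : ℝ)⁻¹ * (classCard t ω : ℝ)⁻¹ - 1 := by
    intro ω
    have a1 : (0 : ℝ) < classCard (r ⊓ t) ω := by exact_mod_cast classCard_pos _ ω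
    have a2 : (0 : ℝ) < classCard (s ⊓ t) ω := by exact_mod_cast classCard_pos _ ω
    have a3 : (0 : ℝ) < classCard (r ⊓ (s ⊓ t)) ω := by exact_mod_cast classCard_pos _ ω
    have a4 : (0 : ℝ) < classCard t ω := by exact_mod_cast classCard_pos _ ω
    refine le_trans (le_of_eq ?_) (Real.log_le_sub_one_of_pos (by positivity))
    rw [Real.log_mul (by positivity) (by positivity), Real.log_mul (by positivity) (by positivity),
      Real.log_mul (by positivity) (by positivity), Real.log_inv, Real.log_inv]
    ring
  have hs := Finset.sum_le_sum fun ω (_ : ω ∈ (Finset.univ : Finset Ω)) => hpt ω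
  rw [Finset.sum_sub_distrib, Finset.sum_sub_distrib, Finset.sum_add_distrib,
    Finset.sum_sub_distrib] at hs
  unfold partitionEntropy
  rw [← add_div, ← add_div]
  refine (div_le_div_iff_of_pos_right hn0).mpr ?_
  simp only [Finset.sum_sub_distrib]
  simp only [Finset.sum_const, Finset.card_univ, nsmul_eq_mul, mul_one] at hs
  linarith

theorem partitionEntropy_inf_le (r s : Setoid Ω) :
    partitionEntropy (r ⊓ s) ≤ partitionEntropy r + partitionEntropy s := by
  have := partitionEntropy_submodular r s ⊤
  simp only [inf_top_eq, partitionEntropy_top, add_zero] at this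
  exact this

theorem partitionEntropy_finset_inf_le {ι : Type*} (A : Finset ι) (w : ι → Setoid Ω) :
    partitionEntropy (A.inf w) ≤ ∑ j ∈ A, partitionEntropy (w j) := by
  classical
  induction A using Finset.induction_on with
  | empty => simp [partitionEntropy_top]
  | insert a A ha ih =>
    rw [Finset.inf_insert, Finset.sum_insert ha]
    linarith [partitionEntropy_inf_le (w a) (A.inf w)]

/-- Subadditivity of the conditional entropy. -/
theorem partitionEntropy_cond_finset_inf_le {ι : Type*} (A : Finset ι) (w : ι → Setoid Ω)
    (y : Setoid Ω) :
    partitionEntropy (A.inf w ⊓ y) - partitionEntropy y ≤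
      ∑ j ∈ A, (partitionEntropy (w j ⊓ y) - partitionEntropy y) := by
  classical
  induction A using Finset.induction_on with
  | empty => simp
  | insert a A ha ih =>
    rw [Finset.inf_insert, Finset.sum_insert ha, inf_assoc]
    linarith [partitionEntropy_submodular (w a) (A.inf w) y]

/-- The signal `y`, together with the side information `z i`, determines `v i`: the entropy of
`y` is at least the sum of the entropies of the `v i`, each conditioned on what has been decoded
before and on the side information used so far. -/
theorem sum_cond_le_partitionEntropy (y : Setoid Ω) (z v : ℕ → Setoid Ω) (s : ℕ)
    (h : ∀ i < s, y ⊓ z i ≤ v i) :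
    ∑ i ∈ Finset.range s,
      (partitionEntropy (v i ⊓ ((Finset.range (i + 1)).inf z ⊓ (Finset.range i).inf v)) -
        partitionEntropy ((Finset.range (i + 1)).inf z ⊓ (Finset.range i).inf v)) ≤
      partitionEntropy y := by
  -- Invariant: the entropy already extracted plus what remains in `y` given everything seen so far
  -- never exceeds the entropy of `y`.
  have main : ∀ i ≤ s, ∑ j ∈ Finset.range i,
      (partitionEntropy (v j ⊓ ((Finset.range (j + 1)).inf z ⊓ (Finset.range j).inf v)) -
        partitionEntropy ((Finset.range (j + 1)).inf z ⊓ (Finset.range j).inf v)) +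
      (partitionEntropy (y ⊓ ((Finset.range i).inf z ⊓ (Finset.range i).inf v)) -
        partitionEntropy ((Finset.range i).inf z ⊓ (Finset.range i).inf v)) ≤
      partitionEntropy y := by
    intro i
    induction i with
    | zero => simp [partitionEntropy_top]
    | succ i ih =>
      intro hi
      have ih := ih (by omega)
      rw [Finset.sum_range_succ]
      have e1 : (Finset.range (i + 1)).inf z ⊓ (Finset.range (i + 1)).inf v =
          v i ⊓ ((Finset.range (i + 1)).inf z ⊓ (Finset.range i).inf v) := by
        rw [Finset.range_add_one (n := i), Finset.inf_insert (f := v)]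
        ac_rfl
      have e2 : (Finset.range (i + 1)).inf z ⊓ (Finset.range i).inf v =
          z i ⊓ ((Finset.range i).inf z ⊓ (Finset.range i).inf v) := by
        rw [Finset.range_add_one, Finset.inf_insert, inf_assoc]
      -- Once `y` and `z i` are known, adjoining `v i` refines nothing.
      have e3 : y ⊓ (v i ⊓ ((Finset.range (i + 1)).inf z ⊓ (Finset.range i).inf v)) =
          y ⊓ (z i ⊓ ((Finset.range i).inf z ⊓ (Finset.range i).inf v)) := by
        rw [e2]
        apply le_antisymm
        · exact inf_le_inf_left _ inf_le_right
        · refine le_inf inf_le_left (le_inf ?_ inf_le_right)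
          exact (le_inf inf_le_left (inf_le_right.trans inf_le_left)).trans (h i (by omega))
      have hsub := partitionEntropy_submodular y (z i)
        ((Finset.range i).inf z ⊓ (Finset.range i).inf v)
      rw [e1, e3, e2]
      linarith
  have h1 := main s le_rfl
  have h2 := partitionEntropy_anti
    (show y ⊓ ((Finset.range s).inf z ⊓ (Finset.range s).inf v) ≤ _ from inf_le_right)
  linarith

end PartitionEntropy

/-! ### Converse: lower bound on the signal length. -/

theorem log_card_bits (n : ℕ) : Real.log (Fintype.card (Fin n → Bool)) = n * Real.log 2 := by
  simp

theorem partitionEntropy_ker_bits_le {Ω : Type*} [Fintype Ω] [Nonempty Ω] {n : ℕ}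
    (X : Ω → (Fin n → Bool)) : partitionEntropy (Setoid.ker X) ≤ n * Real.log 2 :=
  (partitionEntropy_ker_le_log_card X).trans_eq (log_card_bits n)

/-- Some file that is not yet decoded has a large conditional entropy, given side information `P`
of small entropy and the decoded files. -/
theorem exists_file_cond_entropy_ge {N F : ℕ} (P : Setoid (Library N F)) {c : ℝ} (hc0 : 0 ≤ c)
    (hP : partitionEntropy P ≤ c) (B : Finset (Fin N)) {b : ℕ} (hB : B.card ≤ b) (hb : b < N) :
    ∃ j, F * Real.log 2 - c / ((N : ℝ) - b) ≤
      partitionEntropy (Setoid.ker (fun W : Library N F => W j) ⊓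
        (P ⊓ B.inf fun j => Setoid.ker fun W : Library N F => W j)) -
      partitionEntropy (P ⊓ B.inf fun j => Setoid.ker fun W : Library N F => W j) := by
  classical
  obtain ⟨w, hw⟩ : ∃ w : Fin N → Setoid (Library N F),
    w = fun j => Setoid.ker fun W : Library N F => W j := ⟨_, rfl⟩
  have hwj : ∀ j, Setoid.ker (fun W : Library N F => W j) = w j := fun j => by rw [hw]
  rw [← hw]
  simp only [hwj]
  -- Averaging over the files outside `B`: if each of them fell short, their joint conditional
  -- entropy would be too small for the whole library to have entropy `N * (F * log 2)`.
  by_contra! hcon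
  have h1 := partitionEntropy_cond_finset_inf_le Bᶜ w (P ⊓ B.inf w)
  have hBc : (Bᶜ.card : ℝ) = N - B.card := by
    rw [Finset.card_compl, Fintype.card_fin, Nat.cast_sub (by omega)]
  have hbR : (B.card : ℝ) ≤ b := by exact_mod_cast hB
  have hbN : (b : ℝ) < N := by exact_mod_cast hb
  have hne : Bᶜ.Nonempty := by
    rw [← Finset.card_pos, Finset.card_compl, Fintype.card_fin]; omega
  have h2 := Finset.sum_lt_sum_of_nonempty hne fun j _ => hcon j
  rw [Finset.sum_const, nsmul_eq_mul, hBc] at h2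
  have hbot : Bᶜ.inf w ⊓ (P ⊓ B.inf w) ≤ ⊥ := by
    intro W V h
    have hall : ∀ j, W j = V j := by
      intro j
      have hker : w j W V := by
        by_cases hj : j ∈ B
        · exact (show _ ≤ w j from inf_le_right.trans (inf_le_right.trans (Finset.inf_le hj))) h
        · exact (show _ ≤ w j from
            inf_le_left.trans (Finset.inf_le (Finset.mem_compl.mpr hj))) h
      rw [hw] at hker
      exact hker
    exact funext hall
  have h3 := partitionEntropy_anti hbot
  have h4 : Real.log (Fintype.card (Library N F)) = N * (F * Real.log 2) := by
    simp
  rw [partitionEntropy_bot, h4] at h3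
  have h5 := partitionEntropy_inf_le P (B.inf w)
  have h6 := partitionEntropy_finset_inf_le B w
  have h7 : ∑ j ∈ B, partitionEntropy (w j) ≤ B.card * (F * Real.log 2) := by
    rw [← nsmul_eq_mul]
    refine Finset.sum_le_card_nsmul _ _ _ fun j _ => ?_
    rw [← hwj]
    exact partitionEntropy_ker_bits_le _
  -- Repeated requests can make `B` smaller than `b`; then more files share the loss `c`, which only
  -- helps.
  have h8 : c ≤ ((N : ℝ) - B.card) * (c / (N - b)) := by
    rw [← mul_div_assoc, le_div_iff₀ (by linarith)]
    nlinarith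
  nlinarith

/-- A request under which every user in turn asks for a file that is hard to guess from the caches
seen so far and the files decoded so far. -/
theorem exists_demand_cond_entropy_ge {N F : ℕ} (z : ℕ → Setoid (Library N F)) {c : ℝ}
    (hz : ∀ i, partitionEntropy (z i) ≤ c) (hc0 : 0 ≤ c) (hN : 0 < N) (s : ℕ) (hs : s ≤ N) :
    ∃ d : ℕ → Fin N, ∀ i < s, F * Real.log 2 - (i + 1) * c / ((N : ℝ) - i) ≤
      partitionEntropy (Setoid.ker (fun W : Library N F => W (d i)) ⊓
        ((Finset.range (i + 1)).inf z ⊓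
          (Finset.range i).inf fun i => Setoid.ker fun W : Library N F => W (d i))) -
      partitionEntropy ((Finset.range (i + 1)).inf z ⊓
          (Finset.range i).inf fun i => Setoid.ker fun W : Library N F => W (d i)) := by
  classical
  induction s with
  | zero => exact ⟨fun _ => ⟨0, hN⟩, by simp⟩
  | succ s ih =>
    obtain ⟨d, hd⟩ := ih (by omega)
    have hP : partitionEntropy ((Finset.range (s + 1)).inf z) ≤ (s + 1) * c := by
      refine (partitionEntropy_finset_inf_le _ z).trans
        ((Finset.sum_le_card_nsmul _ _ c fun i _ => hz i).trans_eq ?_)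
      simp
    obtain ⟨j, hj⟩ := exists_file_cond_entropy_ge _ (by positivity) hP
      ((Finset.range s).image d) (Finset.card_image_le.trans (Finset.card_range s).le)
      (by omega)
    rw [Finset.inf_image] at hj
    have hpre : ∀ i ≤ s, ((Finset.range i).inf fun i =>
        Setoid.ker fun W : Library N F => W (Function.update d s j i)) =
        (Finset.range i).inf fun i => Setoid.ker fun W : Library N F => W (d i) := by
      intro i hi
      refine Finset.inf_congr rfl fun l hl => ?_
      rw [Function.update_of_ne (by have := Finset.mem_range.mp hl; omega)]
    refine ⟨Function.update d s j, fun i hi => ?_⟩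
    rw [hpre i (by omega)]
    rcases Nat.lt_succ_iff_lt_or_eq.mp hi with h | rfl
    · rw [Function.update_of_ne h.ne]
      exact hd i h
    · rw [Function.update_self]
      exact hj

/-- The entropy of the correction that a user needs to recover its file without error. -/
theorem partitionEntropy_correction_le {Ω : Type*} [Fintype Ω] [Nonempty Ω] {n : ℕ}
    (X Y : Ω → (Fin n → Bool)) {ε : ℝ}
    (hε : ((Finset.univ.filter fun ω => Y ω ≠ X ω).card : ℝ) / Fintype.card Ω ≤ ε) :
    partitionEntropy (Setoid.ker fun ω => if Y ω ≠ X ω then some (X ω) else none) ≤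
      Real.log 2 + ε * (n * Real.log 2) := by
  have hΩ : (0 : ℝ) < Fintype.card Ω := by exact_mod_cast Fintype.card_pos
  have hL : 0 < Real.log 2 := Real.log_pos (by norm_num)
  -- Half of the mass sits on "no error", the other half is uniform on the `2 ^ n` strings: a flag
  -- costs one bit, and an error costs `n` further bits. Gibbs' inequality then gives a Fano-type
  -- bound.
  let q : Option (Fin n → Bool) → ℝ := fun o => o.elim 2⁻¹ fun _ => 2⁻¹ * (2 ^ n)⁻¹
  have hq : ∀ a, 0 < q a := by
    rintro (_ | a) <;> simp [q]
  have hsum : ∑ a, q a ≤ 1 := by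
    rw [Fintype.sum_option]
    simp only [q, Option.elim_none, Option.elim_some, Finset.sum_const, Finset.card_univ,
      Fintype.card_pi, Fintype.card_bool, Finset.prod_const, Fintype.card_fin, nsmul_eq_mul]
    push_cast
    field_simp
    norm_num
  refine (partitionEntropy_ker_le _ q hq hsum).trans ?_
  rw [div_le_iff₀ hΩ]
  have hpt : ∀ ω, -Real.log (q (if Y ω ≠ X ω then some (X ω) else none)) =
      Real.log 2 + if Y ω ≠ X ω then n * Real.log 2 else 0 := by
    intro ω
    by_cases h : Y ω ≠ X ω
    · simp only [if_pos h, q, Option.elim_some]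
      rw [Real.log_mul (by positivity) (by positivity), Real.log_inv, Real.log_inv, Real.log_pow]
      ring
    · simp only [if_neg h, q, Option.elim_none]
      rw [Real.log_inv]
      ring
  simp_rw [hpt]
  rw [Finset.sum_add_distrib, ← Finset.sum_filter, Finset.sum_const, Finset.sum_const,
    nsmul_eq_mul, nsmul_eq_mul, Finset.card_univ]
  rw [div_le_iff₀ hΩ] at hε
  have := mul_le_mul_of_nonneg_right hε (show 0 ≤ n * Real.log 2 by positivity)
  linarith

/-- Adjoining to the signal the corrections of the first `s` users makes decoding exact, so the
chain rule applies; the corrections cost at most `1 + ε * F` bits each. -/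
theorem Scheme.converse {K N F : ℕ} (S : Scheme K N F) (hNK : K ≤ N) (hN : 0 < N) {ε : ℝ}
    (herr : ∀ d k, S.errorProb d k ≤ ε) {s : ℕ} (hs : s ≤ K) :
    ∑ i ∈ Finset.range s, (F - ((i : ℝ) + 1) * S.cacheBits / ((N : ℝ) - i)) ≤
      S.sentBits + s * (1 + ε * F) := by
  classical
  have hL : 0 < Real.log 2 := Real.log_pos (by norm_num)
  -- Indices beyond the last user carry the trivial partition, of entropy zero.
  obtain ⟨z, hz⟩ : ∃ z : ℕ → Setoid (Library N F), ∀ i, z i =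
      if h : i < K then Setoid.ker (S.cache ⟨i, h⟩) else ⊤ := ⟨_, fun _ => rfl⟩
  have hzc : ∀ i, partitionEntropy (z i) ≤ S.cacheBits * Real.log 2 := by
    intro i
    rw [hz]
    split_ifs with h
    · exact partitionEntropy_ker_bits_le _
    · rw [partitionEntropy_top]; positivity
  obtain ⟨d, hd⟩ := exists_demand_cond_entropy_ge z hzc (by positivity) hN s (hs.trans hNK)
  let D : Demand K N := fun k => d k
  let g : Fin K → Setoid (Library N F) := fun k => Setoid.ker fun W : Library N F =>
    if S.output D k W ≠ W (D k) then some (W (D k)) else none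
  have hg : ∀ k, partitionEntropy (g k) ≤ Real.log 2 + ε * (F * Real.log 2) :=
    fun k => partitionEntropy_correction_le (fun W : Library N F => W (D k)) (S.output D k)
      (by simpa only [Scheme.errorProb] using herr D k)
  let U : Finset (Fin K) := Finset.univ.filter fun k => k.val < s
  have hU : U.card ≤ s := by
    have : U.card ≤ (Finset.range s).card := Finset.card_le_card_of_injOn (fun k => k.val)
      (by intro k hk; simpa [U] using hk) (fun a _ b _ h => Fin.ext h)
    simpa using this
  -- Nonnegativity of `ε` is inherited from an error probability, which needs a user to exist.
  have hε : 0 ≤ Real.log 2 + ε * (F * Real.log 2) ∨ s = 0 := by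
    rcases Nat.eq_zero_or_pos s with h | h
    · exact Or.inr h
    · have h0 := herr D ⟨0, h.trans_le hs⟩
      have : 0 ≤ S.errorProb D ⟨0, h.trans_le hs⟩ := by unfold Scheme.errorProb; positivity
      have : 0 ≤ ε := this.trans h0
      exact Or.inl (by positivity)
  have hy : partitionEntropy (Setoid.ker (S.send D) ⊓ U.inf g) ≤
      S.sentBits * Real.log 2 + s * (Real.log 2 + ε * (F * Real.log 2)) := by
    refine (partitionEntropy_inf_le _ _).trans (add_le_add (partitionEntropy_ker_bits_le _) ?_)
    refine (partitionEntropy_finset_inf_le _ _).trans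
      ((Finset.sum_le_card_nsmul _ _ _ fun k _ => hg k).trans ?_)
    rw [nsmul_eq_mul]
    rcases hε with h | h
    · exact mul_le_mul_of_nonneg_right (by exact_mod_cast hU) h
    · have : U.card = 0 := by omega
      simp [this, h]
  have hdec : ∀ i < s, (Setoid.ker (S.send D) ⊓ U.inf g) ⊓ z i ≤
      Setoid.ker fun W : Library N F => W (d i) := by
    intro i hi
    have hiK : i < K := hi.trans_le hs
    rw [hz, dif_pos hiK]
    rintro W V ⟨⟨h1, h2⟩, h3⟩
    have h2 : g ⟨i, hiK⟩ W V :=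
      (show U.inf g ≤ g ⟨i, hiK⟩ from Finset.inf_le (by simpa [U] using hi)) h2
    have hout : S.output D ⟨i, hiK⟩ W = S.output D ⟨i, hiK⟩ V := by
      have h1 : S.send D W = S.send D V := h1
      have h3 : S.cache ⟨i, hiK⟩ W = S.cache ⟨i, hiK⟩ V := h3
      simp only [Scheme.output, h1, h3]
    have h2 : (if S.output D ⟨i, hiK⟩ W ≠ W (D ⟨i, hiK⟩) then some (W (D ⟨i, hiK⟩)) else none) =
      if S.output D ⟨i, hiK⟩ V ≠ V (D ⟨i, hiK⟩) then some (V (D ⟨i, hiK⟩)) else none := h2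
    show W (D ⟨i, hiK⟩) = V (D ⟨i, hiK⟩)
    by_cases hW : S.output D ⟨i, hiK⟩ W = W (D ⟨i, hiK⟩)
    · by_cases hV : S.output D ⟨i, hiK⟩ V = V (D ⟨i, hiK⟩)
      · rw [← hW, ← hV, hout]
      · simp [hW, hV] at h2
    · by_cases hV : S.output D ⟨i, hiK⟩ V = V (D ⟨i, hiK⟩)
      · simp [hW, hV] at h2
      · simpa [hW, hV] using h2
  have hchain := sum_cond_le_partitionEntropy _ z
    (fun i => Setoid.ker fun W : Library N F => W (d i)) s hdec
  have hsum := Finset.sum_le_sum fun i (hi : i ∈ Finset.range s) => hd i (Finset.mem_range.mp hi)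
  have hall := (hsum.trans hchain).trans hy
  refine le_of_mul_le_mul_right ?_ hL
  rw [Finset.sum_mul]
  refine le_trans (le_of_eq (Finset.sum_congr rfl fun i _ => ?_)) (hall.trans_eq ?_)
  · ring
  · ring

/-- The finite-length converse is divided by `F`, and the correction cost vanishes in the limit. -/
theorem Achievable.lower_bound {K N : ℕ} {M T : ℝ} (h : Achievable K N M T) (hNK : K ≤ N)
    (hN : 0 < N) {s : ℕ} (hs : s ≤ K) :
    ∑ i ∈ Finset.range s, (1 - ((i : ℝ) + 1) * M / ((N : ℝ) - i)) ≤ T := by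
  refine le_of_forall_pos_le_add fun η hη => ?_
  -- For `F ≥ 1 / ε` the overhead `1 + ε * F` is at most `2 * ε * F`; adding the slack in the delay
  -- gives `ε + s * (2 * ε)` per unit of `F`.
  obtain ⟨ε, hε, hεη⟩ : ∃ ε : ℝ, 0 < ε ∧ ε + s * (2 * ε) ≤ η :=
    ⟨η / (1 + 2 * s), by positivity, le_of_eq (by field_simp)⟩
  obtain ⟨F₀, hF₀⟩ := exists_nat_gt (1 / ε)
  obtain ⟨F, ⟨S, hc, hdel, herr⟩, hF⟩ :=
    ((h ε hε).and (Filter.eventually_gt_atTop F₀)).exists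
  have hFR : (0 : ℝ) < F := by exact_mod_cast (Nat.zero_le F₀).trans_lt hF
  have hFε : 1 ≤ ε * F := by
    rw [div_lt_iff₀ hε] at hF₀
    have : (F₀ : ℝ) ≤ F := by exact_mod_cast hF.le
    nlinarith
  have hconv := S.converse hNK hN herr hs
  rw [Scheme.delay, div_le_iff₀ hFR] at hdel
  refine le_of_mul_le_mul_right ?_ hFR
  have hterm : (∑ i ∈ Finset.range s, (1 - ((i : ℝ) + 1) * M / ((N : ℝ) - i))) * F ≤
      ∑ i ∈ Finset.range s, (F - ((i : ℝ) + 1) * S.cacheBits / ((N : ℝ) - i)) := by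
    rw [Finset.sum_mul]
    refine Finset.sum_le_sum fun i hi => ?_
    have hiN : (i : ℝ) < N := by
      exact_mod_cast (Finset.mem_range.mp hi).trans_le (hs.trans hNK)
    have : ((i : ℝ) + 1) * S.cacheBits / ((N : ℝ) - i) ≤
        ((i : ℝ) + 1) * (M * F) / ((N : ℝ) - i) :=
      div_le_div_of_nonneg_right (mul_le_mul_of_nonneg_left hc (by positivity)) (by linarith)
    calc _ = (F : ℝ) - ((i : ℝ) + 1) * (M * F) / ((N : ℝ) - i) := by ring
      _ ≤ _ := by linarith
  have hs0 : (0 : ℝ) ≤ s := by positivity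
  have h1 : (s : ℝ) * (1 + ε * F) ≤ s * (2 * ε * F) := by
    refine mul_le_mul_of_nonneg_left ?_ hs0
    linarith
  have h2 := mul_le_mul_of_nonneg_right hεη hFR.le
  linarith

theorem Achievable.nonneg {K N : ℕ} {M T : ℝ} (h : Achievable K N M T) : 0 ≤ T := by
  refine le_of_forall_pos_le_add fun ε hε => ?_
  obtain ⟨F, S, -, hdel, -⟩ := (h ε hε).exists
  exact (show 0 ≤ S.delay by unfold Scheme.delay; positivity).trans hdel

/-! ### Exact schemes and coded multicasting. -/

/-- There is a scheme without errors for files of `F` bits, with caches of `c` bits and signals of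
`s` bits. -/
def ExactScheme (K N F c s : ℕ) : Prop :=
  ∃ S : Scheme K N F, S.cacheBits = c ∧ S.sentBits = s ∧ ∀ d k W, S.output d k W = W (d k)

/-- A scheme over an arbitrary alphabet of two letters, whose files, caches and signals are indexed
by arbitrary finite types. -/
theorem ExactScheme.of_types {K N F c s : ℕ} {G : Type*} (e : G ≃ Bool) {β σ : Type*}
    {δ : Fin K → Type*} [Fintype β] [Fintype σ] [∀ k, Fintype (δ k)]
    (hβ : Fintype.card β = F) (hδ : ∀ k, Fintype.card (δ k) = c) (hσ : Fintype.card σ = s)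
    (cache : ∀ k, (Fin N → β → G) → (δ k → G)) (send : Demand K N → (Fin N → β → G) → (σ → G))
    (decode : Demand K N → ∀ k, (σ → G) → (δ k → G) → (β → G))
    (h : ∀ d k W, decode d k (send d W) (cache k W) = W (d k)) :
    ExactScheme K N F c s := by
  let eβ : β ≃ Fin F := Fintype.equivFinOfCardEq hβ
  let eσ : σ ≃ Fin s := Fintype.equivFinOfCardEq hσ
  let eδ : ∀ k, δ k ≃ Fin c := fun k => Fintype.equivFinOfCardEq (hδ k)
  let lib : Library N F → (Fin N → β → G) := fun W n b => e.symm (W n (eβ b))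
  refine ⟨⟨c, s, fun k W i => e (cache k (lib W) ((eδ k).symm i)),
    fun d W i => e (send d (lib W) (eσ.symm i)),
    fun d k x y i => e (decode d k (fun j => e.symm (x (eσ j))) (fun j => e.symm (y (eδ k j)))
      (eβ.symm i))⟩, rfl, rfl, ?_⟩
  intro d k W
  funext i
  simp [Scheme.output, h, lib]

theorem ExactScheme.zero (K N : ℕ) : ExactScheme K N 0 0 0 :=
  ⟨⟨0, 0, fun _ _ => Fin.elim0, fun _ _ => Fin.elim0, fun _ _ _ _ => Fin.elim0⟩, rfl, rfl,
    fun _ _ _ => funext fun i => i.elim0⟩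

/-- Memory sharing: every file is cut into two segments, which are served independently. -/
theorem ExactScheme.add {K N F₁ F₂ c₁ c₂ s₁ s₂ : ℕ} (h₁ : ExactScheme K N F₁ c₁ s₁)
    (h₂ : ExactScheme K N F₂ c₂ s₂) : ExactScheme K N (F₁ + F₂) (c₁ + c₂) (s₁ + s₂) := by
  obtain ⟨S₁, rfl, rfl, h₁⟩ := h₁
  obtain ⟨S₂, rfl, rfl, h₂⟩ := h₂
  refine ExactScheme.of_types (Equiv.refl Bool) (β := Fin F₁ ⊕ Fin F₂)
    (σ := Fin S₁.sentBits ⊕ Fin S₂.sentBits) (δ := fun _ => Fin S₁.cacheBits ⊕ Fin S₂.cacheBits)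
    (by simp) (by simp) (by simp)
    (fun k W => Sum.elim (S₁.cache k fun n i => W n (Sum.inl i))
      (S₂.cache k fun n i => W n (Sum.inr i)))
    (fun d W => Sum.elim (S₁.send d fun n i => W n (Sum.inl i))
      (S₂.send d fun n i => W n (Sum.inr i)))
    (fun d k x y => Sum.elim (S₁.decode d k (x ∘ Sum.inl) (y ∘ Sum.inl))
      (S₂.decode d k (x ∘ Sum.inr) (y ∘ Sum.inr))) ?_
  intro d k W
  funext i
  rcases i with i | i
  · exact congrFun (h₁ d k fun n i => W n (Sum.inl i)) i
  · exact congrFun (h₂ d k fun n i => W n (Sum.inr i)) i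

theorem ExactScheme.mul {K N F c s : ℕ} (h : ExactScheme K N F c s) (m : ℕ) :
    ExactScheme K N (m * F) (m * c) (m * s) := by
  induction m with
  | zero => simpa using ExactScheme.zero K N
  | succ m ih =>
    simp only [Nat.succ_mul]
    exact ih.add h

open Finset in
/-- The number of subsets with `t` elements that contain `k`. -/
theorem card_powersetCard_filter_mem {α : Type*} [Fintype α] [DecidableEq α] (t : ℕ) (k : α) :
    Fintype.card α * ((powersetCard t (univ : Finset α)).filter (k ∈ ·)).card =
      t * (Fintype.card α).choose t := by
  have h1 : ((powersetCard t (univ : Finset α)).filter (k ∉ ·)).card =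
      (Fintype.card α - 1).choose t := by
    have : (powersetCard t (univ : Finset α)).filter (k ∉ ·) =
        powersetCard t (univ.erase k) := by
      ext A
      simp only [mem_filter, mem_powersetCard, subset_univ, true_and, subset_erase]
      tauto
    rw [this, card_powersetCard, card_erase_of_mem (mem_univ _), card_univ]
  have h2 := card_filter_add_card_filter_not (s := powersetCard t (univ : Finset α)) (k ∈ ·)
  rw [h1, card_powersetCard, card_univ] at h2
  obtain ⟨n, hn⟩ : ∃ n, Fintype.card α = n + 1 :=
    ⟨Fintype.card α - 1, by have := Fintype.card_pos_iff.mpr ⟨k⟩; omega⟩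
  rw [hn] at h2 ⊢
  cases t with
  | zero => simp at h2 ⊢
  | succ t =>
    simp only [Nat.add_sub_cancel] at h2
    have h3 := Nat.choose_succ_succ n t
    have h4 := Nat.add_one_mul_choose_eq n t
    have h5 : #{x ∈ powersetCard (t + 1) (univ : Finset α) | k ∈ x} = n.choose t := by
      simp only [Nat.succ_eq_add_one] at h3
      omega
    rw [h5, h4]
    ring

open Finset in
/-- The coded multicasting scheme: the file pieces are indexed by the sets of `t` users, each piece
is cached by the users in its index, and the sums over the sets of `t + 1` users are sent. -/
theorem exactScheme_multicast (K N t c : ℕ) (hK : 0 < K) (hc : K * c = t * K.choose t) :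
    ExactScheme K N (K.choose t) (N * c) (K.choose (t + 1)) := by
  classical
  -- Any bijection will do; `ZMod 2` supplies the addition used to combine pieces.
  have e : ZMod 2 ≃ Bool := Fintype.equivOfCardEq (by simp [ZMod.card])
  refine ExactScheme.of_types e
    (β := {A : Finset (Fin K) // A ∈ powersetCard t univ})
    (σ := {A : Finset (Fin K) // A ∈ powersetCard (t + 1) univ})
    (δ := fun k => Fin N × {A : Finset (Fin K) // A ∈ (powersetCard t univ).filter (k ∈ ·)})
    (by rw [Fintype.card_coe]; simp) ?_ (by rw [Fintype.card_coe]; simp)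
    (fun k W p => W p.1 ⟨p.2.1, (mem_filter.mp p.2.2).1⟩)
    (fun d W S => ∑ j : Fin K, if hj : j ∈ S.1 then
      W (d j) ⟨S.1.erase j, mem_powersetCard.mpr ⟨subset_univ _, by
        rw [card_erase_of_mem hj, (mem_powersetCard.mp S.2).2]; rfl⟩⟩ else 0)
    (fun d k x y A => if hk : k ∈ A.1 then y (d k, ⟨A.1, mem_filter.mpr ⟨A.2, hk⟩⟩) else
      x ⟨insert k A.1, mem_powersetCard.mpr ⟨subset_univ _, by
        rw [card_insert_of_notMem hk, (mem_powersetCard.mp A.2).2]⟩⟩ -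
      ∑ j : Fin K, if hj : j ∈ A.1 then
        y (d j, ⟨(insert k A.1).erase j, mem_filter.mpr ⟨mem_powersetCard.mpr ⟨subset_univ _, by
          rw [card_erase_of_mem (mem_insert_of_mem hj), card_insert_of_notMem hk,
            (mem_powersetCard.mp A.2).2]; rfl⟩,
          mem_erase.mpr ⟨fun h => hk (h ▸ hj), mem_insert_self _ _⟩⟩⟩) else 0) ?_
  · intro k
    rw [Fintype.card_prod, Fintype.card_fin, Fintype.card_coe]
    congr 1
    have := card_powersetCard_filter_mem t k
    rw [Fintype.card_fin, ← hc] at this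
    exact Nat.eq_of_mul_eq_mul_left hK this
  · intro d k W
    funext A
    by_cases hk : k ∈ A.1
    · simp [hk]
    · simp only [hk, dite_false]
      -- User `k` has cached every summand of the message for `insert k A` except its own, so
      -- subtracting them leaves the wanted piece `A`.
      have key : ∀ (f g : Fin K → ZMod 2) (a : ZMod 2), f k = a → g k = 0 →
          (∀ j, j ≠ k → f j = g j) → ∑ j, f j - ∑ j, g j = a := by
        intro f g a ha hg hfg
        rw [← sum_sub_distrib, sum_eq_single k, ha, hg, sub_zero]
        · intro j _ hj
          rw [hfg j hj, sub_self]
        · simp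
      refine key _ _ _ ?_ (by simp [hk]) ?_
      · simp [erase_insert hk]
      · intro j hjk
        by_cases hjA : j ∈ A.1
        · simp [hjA]
        · simp [hjA, hjk]

/-! ### Achievability by memory sharing. -/

theorem ZeroErrorAchievable.achievable {K N : ℕ} {M T : ℝ} (h : ZeroErrorAchievable K N M T) :
    Achievable K N M T := by
  intro ε hε
  filter_upwards [h ε hε] with F ⟨S, h1, h2, h3⟩
  refine ⟨S, h1, h2, fun d k => ?_⟩
  simp [Scheme.errorProb, h3, hε.le]

theorem zeroErrorAchievable_sharedDelay (K N t : ℕ) (M γ : ℝ) (hNK : K ≤ N) (ht : t < K)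
    (hγ : γ = M / (N : ℝ)) (hlo : (t : ℝ) ≤ (K : ℝ) * γ) (hhi : (K : ℝ) * γ ≤ (t : ℝ) + 1) :
    ZeroErrorAchievable K N M (sharedDelay K t γ) := by
  have hK : 0 < K := by omega
  have hKR : (0 : ℝ) < K := by exact_mod_cast hK
  have hNR : (0 : ℝ) < N := by exact_mod_cast hK.trans_le hNK
  have hM : M = N * γ := by rw [hγ]; field_simp
  -- `θ` is the fraction of every file served by the scheme with parameter `t + 1`.
  obtain ⟨θ, hθ⟩ : ∃ θ, θ = (K : ℝ) * γ - t := ⟨_, rfl⟩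
  have hθ0 : 0 ≤ θ := by linarith
  have hθ1 : 0 ≤ 1 - θ := by linarith
  have hcount : ∀ u : ℕ, ∃ c, K * c = u * K.choose u := fun u => by
    have := card_powersetCard_filter_mem u (⟨0, hK⟩ : Fin K)
    rw [Fintype.card_fin] at this
    exact ⟨_, this⟩
  obtain ⟨c₁, hc₁⟩ := hcount t
  obtain ⟨c₂, hc₂⟩ := hcount (t + 1)
  have hC₁ : 0 < K.choose t := Nat.choose_pos ht.le
  have hC₂ : 0 < K.choose (t + 1) := Nat.choose_pos ht
  have hs₁ : (K.choose (t + 1) : ℝ) = K.choose t * (((K : ℝ) - t) / (t + 1)) := by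
    have := Nat.choose_succ_right_eq K t
    have h2 : ((K - t : ℕ) : ℝ) = (K : ℝ) - t := Nat.cast_sub ht.le
    have h3 : (K.choose (t + 1) : ℝ) * (t + 1) = K.choose t * ((K : ℝ) - t) := by
      rw [← h2]; exact_mod_cast this
    field_simp
    linarith
  have hs₂ : (K.choose (t + 2) : ℝ) = K.choose (t + 1) * (((K : ℝ) - (t + 1)) / (t + 2)) := by
    have := Nat.choose_succ_right_eq K (t + 1)
    have h2 : ((K - (t + 1) : ℕ) : ℝ) = (K : ℝ) - (t + 1) := by
      rw [Nat.cast_sub ht]; push_cast; ring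
    have h3 : (K.choose (t + 2) : ℝ) * (t + 2) = K.choose (t + 1) * ((K : ℝ) - (t + 1)) := by
      rw [← h2]; exact_mod_cast this
    field_simp
    linarith
  have hc₁R : (K : ℝ) * c₁ = t * K.choose t := by exact_mod_cast hc₁
  have hc₂R : (K : ℝ) * c₂ = (t + 1) * K.choose (t + 1) := by exact_mod_cast hc₂
  have htK : (t : ℝ) + 1 ≤ K := by exact_mod_cast ht
  intro ε hε
  -- Rounding both segments down leaves at most `K.choose t + K.choose (t + 1)` bits of every file;
  -- sending each uncached costs `K` bits, within `ε * F` in total.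
  obtain ⟨F₀, hF₀⟩ := exists_nat_gt ((K : ℝ) * (K.choose t + K.choose (t + 1)) / ε)
  filter_upwards [Filter.eventually_gt_atTop F₀] with F hF
  have hFR : (0 : ℝ) < F := by exact_mod_cast (Nat.zero_le F₀).trans_lt hF
  have hFε : (K : ℝ) * (K.choose t + K.choose (t + 1)) ≤ ε * F := by
    rw [div_lt_iff₀ hε] at hF₀
    have : (F₀ : ℝ) ≤ F := by exact_mod_cast hF.le
    nlinarith
  have hC₁R : (0 : ℝ) < K.choose t := by exact_mod_cast hC₁
  have hC₂R : (0 : ℝ) < K.choose (t + 1) := by exact_mod_cast hC₂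
  obtain ⟨m₁, hm₁, hm₁'⟩ : ∃ m : ℕ, (m : ℝ) * K.choose t ≤ (1 - θ) * F ∧
      (1 - θ) * F ≤ (m : ℝ) * K.choose t + K.choose t := by
    refine ⟨⌊(1 - θ) * F / K.choose t⌋₊, ?_, ?_⟩
    · rw [← le_div_iff₀ hC₁R]; exact Nat.floor_le (by positivity)
    · have := (Nat.lt_floor_add_one ((1 - θ) * F / K.choose t)).le
      rw [div_le_iff₀ hC₁R] at this; linarith
  obtain ⟨m₂, hm₂, hm₂'⟩ : ∃ m : ℕ, (m : ℝ) * K.choose (t + 1) ≤ θ * F ∧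
      θ * F ≤ (m : ℝ) * K.choose (t + 1) + K.choose (t + 1) := by
    refine ⟨⌊θ * F / K.choose (t + 1)⌋₊, ?_, ?_⟩
    · rw [← le_div_iff₀ hC₂R]; exact Nat.floor_le (by positivity)
    · have := (Nat.lt_floor_add_one (θ * F / K.choose (t + 1))).le
      rw [div_le_iff₀ hC₂R] at this; linarith
  have hle : m₁ * K.choose t + m₂ * K.choose (t + 1) ≤ F := by
    have : (m₁ : ℝ) * K.choose t + m₂ * K.choose (t + 1) ≤ F := by linarith
    exact_mod_cast this
  obtain ⟨r, hr⟩ := Nat.exists_eq_add_of_le hle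
  have hrR : (F : ℝ) = m₁ * K.choose t + m₂ * K.choose (t + 1) + r := by exact_mod_cast hr
  have hS := (((exactScheme_multicast K N t c₁ hK hc₁).mul m₁).add
    ((exactScheme_multicast K N (t + 1) c₂ hK hc₂).mul m₂)).add
    -- The multicast scheme with parameter `0` serves the leftover bits: no cache, one message per
    -- user.
    ((exactScheme_multicast K N 0 0 hK (by simp)).mul r)
  simp only [Nat.choose_zero_right, mul_one, zero_add, Nat.choose_one_right, mul_zero,
    add_zero] at hS
  rw [← hr] at hS
  obtain ⟨S, hSc, hSs, hSo⟩ := hS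
  refine ⟨S, ?_, ?_, hSo⟩
  · rw [Scheme.FitsCache, hSc, hM]
    push_cast
    refine le_of_mul_le_mul_left ?_ hKR
    calc (K : ℝ) * (m₁ * (N * c₁) + m₂ * (N * c₂))
        = N * (m₁ * (K * c₁) + m₂ * (K * c₂)) := by ring
      _ = N * (t * (m₁ * K.choose t) + (t + 1) * (m₂ * K.choose (t + 1))) := by
          rw [hc₁R, hc₂R]; ring
      _ ≤ N * (t * ((1 - θ) * F) + (t + 1) * (θ * F)) := by gcongr
      _ = K * (N * γ * F) := by rw [hθ]; ring
  · rw [Scheme.delay, div_le_iff₀ hFR, hSs]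
    push_cast
    have hr' : (r : ℝ) ≤ K.choose t + K.choose (t + 1) := by linarith
    have e1 : (m₁ : ℝ) * (K.choose t * (((K : ℝ) - t) / (t + 1))) ≤
        (1 - θ) * F * (((K : ℝ) - t) / (t + 1)) := by
      rw [← mul_assoc]
      exact mul_le_mul_of_nonneg_right hm₁ (div_nonneg (by linarith) (by positivity))
    have e2 : (m₂ : ℝ) * (K.choose (t + 1) * (((K : ℝ) - (t + 1)) / (t + 2))) ≤
        θ * F * (((K : ℝ) - (t + 1)) / (t + 2)) := by
      rw [← mul_assoc]
      exact mul_le_mul_of_nonneg_right hm₂ (div_nonneg (by linarith) (by positivity))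
    have e3 : (r : ℝ) * K ≤ ε * F := by nlinarith
    have e4 : sharedDelay K t γ = (1 - θ) * (((K : ℝ) - t) / (t + 1)) +
        θ * (((K : ℝ) - (t + 1)) / (t + 2)) := by
      rw [sharedDelay, hθ]; ring
    rw [e4, show t + 1 + 1 = t + 2 from rfl, hs₂]
    calc (m₁ : ℝ) * K.choose (t + 1) +
          m₂ * (K.choose (t + 1) * (((K : ℝ) - (t + 1)) / (t + 2))) + r * K
        ≤ (1 - θ) * F * (((K : ℝ) - t) / (t + 1)) +
          θ * F * (((K : ℝ) - (t + 1)) / (t + 2)) + ε * F := by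
          have : (m₁ : ℝ) * K.choose (t + 1) = m₁ * (K.choose t * (((K : ℝ) - t) / (t + 1))) := by
            rw [hs₁]
          linarith
      _ = _ := by ring

/-! ### Comparison of the two bounds. -/

theorem sharedDelay_eq (K t : ℕ) (γ : ℝ) :
    sharedDelay K t γ = ((K : ℝ) - t) / ((t : ℝ) + 1) -
      ((K : ℝ) * γ - t) * ((K : ℝ) + 1) / (((t : ℝ) + 1) * ((t : ℝ) + 2)) := by
  unfold sharedDelay
  field_simp
  ring

/-- The lower bound for `N = K` is the weakest one, for a given fraction `γ`; its sum is estimated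
in closed form. -/
theorem lower_bound_sum_ge {K N s : ℕ} {M γ : ℝ} (hNK : K ≤ N) (hs : s ≤ K)
    (hM : M = N * γ) (hγ : 0 ≤ γ) :
    (s : ℝ) - K * γ * (s * (s + 1) / (2 * (K + 1 - s))) ≤
      ∑ i ∈ Finset.range s, (1 - ((i : ℝ) + 1) * M / ((N : ℝ) - i)) := by
  have hsR : (s : ℝ) ≤ K := by exact_mod_cast hs
  have hNKR : (K : ℝ) ≤ N := by exact_mod_cast hNK
  have hden : (0 : ℝ) < K + 1 - s := by linarith
  have hterm : ∀ i ∈ Finset.range s,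
      1 - K * γ * ((i + 1) / (K + 1 - s)) ≤ 1 - ((i : ℝ) + 1) * M / ((N : ℝ) - i) := by
    intro i hi
    have his : (i : ℝ) + 1 ≤ s := by exact_mod_cast Finset.mem_range.mp hi
    have hi0 : (0 : ℝ) ≤ i := by positivity
    have h1 : (0 : ℝ) < N - i := by linarith
    -- The ratio decreases in `N` and increases in `i`, so its extreme case is `N = K`, `i = s - 1`.
    have : (N : ℝ) / (N - i) ≤ K / (K + 1 - s) := by
      rw [div_le_div_iff₀ h1 hden]
      nlinarith
    have h2 := mul_le_mul_of_nonneg_left this (show 0 ≤ ((i : ℝ) + 1) * γ by positivity)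
    have e1 : ((i : ℝ) + 1) * M / ((N : ℝ) - i) = ((i : ℝ) + 1) * γ * (N / (N - i)) := by
      rw [hM]; ring
    have e2 : K * γ * (((i : ℝ) + 1) / (K + 1 - s)) = ((i : ℝ) + 1) * γ * (K / (K + 1 - s)) := by
      ring
    linarith
  refine le_trans (le_of_eq ?_) (Finset.sum_le_sum hterm)
  have hgauss : ∑ i ∈ Finset.range s, ((i : ℝ) + 1) = s * (s + 1) / 2 := by
    clear hterm hden hsR hs
    induction s with
    | zero => simp
    | succ s ih => rw [Finset.sum_range_succ, ih]; push_cast; ring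
  rw [Finset.sum_sub_distrib, ← Finset.mul_sum, ← Finset.sum_div, hgauss, div_div]
  simp

/-- A lower bound within a factor of four, when there are few users. -/
theorem sharedDelay_lt_of_few_users {K t : ℕ} {γ : ℝ} (ht : t < K) (hlo : (t : ℝ) ≤ K * γ)
    (hγ1 : γ < 1) (hK : K < 4 * (t + 1)) :
    sharedDelay K t γ < 4 * (((1 : ℕ) : ℝ) - K * γ *
      (((1 : ℕ) : ℝ) * (((1 : ℕ) : ℝ) + 1) / (2 * (K + 1 - ((1 : ℕ) : ℝ))))) := by
  have hKR : (0 : ℝ) < K := by exact_mod_cast (Nat.zero_le t).trans_lt ht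
  have h4 : (K : ℝ) < 4 * (t + 1) := by exact_mod_cast hK
  -- This upper bound is a multiple of `1 - γ`, like the lower bound for one user, with factor `K /
  -- (t + 1) < 4`.
  have h1 : sharedDelay K t γ ≤ (K - K * γ) / (t + 1) := by
    rw [sharedDelay_eq, ← sub_nonneg]
    have : ((K : ℝ) - K * γ) / (t + 1) - (((K : ℝ) - t) / ((t : ℝ) + 1) -
      ((K : ℝ) * γ - t) * ((K : ℝ) + 1) / (((t : ℝ) + 1) * ((t : ℝ) + 2))) =
      (K * γ - t) * (K - (t + 1)) / ((t + 1) * (t + 2)) := by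
      field_simp
      ring
    rw [this]
    have : (t : ℝ) + 1 ≤ K := by exact_mod_cast ht
    have h2 : (0 : ℝ) ≤ K - (t + 1) := by linarith
    have h3 : (0 : ℝ) ≤ K * γ - t := by linarith
    positivity
  have h2 : 4 * (((1 : ℕ) : ℝ) - K * γ *
      (((1 : ℕ) : ℝ) * (((1 : ℕ) : ℝ) + 1) / (2 * (K + 1 - ((1 : ℕ) : ℝ))))) = 4 * (1 - γ) := by
    push_cast
    rw [show (K : ℝ) + 1 - 1 = K by ring]
    field_simp
    ring
  rw [h2]
  refine h1.trans_lt ?_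
  rw [div_lt_iff₀ (by positivity)]
  nlinarith

/-- A lower bound within a factor of four, when there are many users. -/
theorem sharedDelay_lt_of_many_users {K t s r : ℕ} {γ : ℝ} (hlo : (t : ℝ) ≤ K * γ)
    (hhi : (K : ℝ) * γ ≤ t + 1) (hs : 2 ≤ s) (hr : r < 2 * (t + 1))
    (hK : K = 2 * (t + 1) * s + r) :
    sharedDelay K t γ < 4 * ((s : ℝ) - K * γ * (s * (s + 1) / (2 * (K + 1 - s)))) := by
  obtain ⟨q, rfl⟩ := Nat.exists_eq_add_of_le hs
  have hrR : (r : ℝ) + 1 ≤ 2 * (t + 1) := by exact_mod_cast hr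
  have hKR : (K : ℝ) = 2 * (t + 1) * (2 + q) + r := by rw [hK]; push_cast; ring
  push_cast
  have hq0 : (0 : ℝ) ≤ q := by positivity
  have ht0 : (0 : ℝ) ≤ t := by positivity
  have hr0 : (0 : ℝ) ≤ r := by positivity
  obtain ⟨σ, hσ⟩ : ∃ σ : ℝ, σ = (2 + q) * (2 + q + 1) / (2 * (K + 1 - (2 + q))) := ⟨_, rfl⟩
  rw [← hσ]
  -- `D` is the value of `K + 1 - s` at `r = 0`, hence a lower bound for it.
  obtain ⟨D, hD⟩ : ∃ D : ℝ, D = (2 + q) * (2 * t + 1) + 1 := ⟨_, rfl⟩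
  have hD0 : 0 < D := by rw [hD]; positivity
  have hDK : 2 * D ≤ 2 * (K + 1 - (2 + q)) := by rw [hD, hKR]; nlinarith
  have hσD : σ ≤ (2 + q) * (2 + q + 1) / (2 * D) := by
    rw [hσ]
    exact div_le_div_of_nonneg_left (by positivity) (by positivity) hDK
  rw [le_div_iff₀ (by positivity)] at hσD
  -- The endpoint `K * γ = t`.
  have hA : ((K : ℝ) - t) / (t + 1) < 4 * ((2 + q) - t * σ) := by
    have h1 : ((K : ℝ) - t) / (t + 1) ≤ 2 * (2 + q) + 1 := by
      rw [div_le_iff₀ (by positivity), hKR]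
      nlinarith
    refine h1.trans_lt (lt_of_mul_lt_mul_right ?_ hD0.le)
    have h2 := mul_le_mul_of_nonneg_left hσD (show 0 ≤ 2 * (t : ℝ) by positivity)
    -- The coefficient of `t` is `2 * s * (s - 2)`, so `s ≥ 2` is what makes this positive; writing
    -- `s = 2 + q` leaves only positive coefficients.
    have h3 : 0 < (2 * (2 + q) - 1) * D - 2 * t * ((2 + q) * (2 + q + 1)) := by
      rw [hD]; ring_nf; positivity
    nlinarith
  -- The endpoint `K * γ = t + 1`.
  have hB : ((K : ℝ) - (t + 1)) / (t + 2) < 4 * ((2 + q) - (t + 1) * σ) := by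
    have h1 : ((K : ℝ) - (t + 1)) / (t + 2) ≤ (2 * (t + 1) * (2 + q) + t) / (t + 2) := by
      refine div_le_div_of_nonneg_right ?_ (by positivity)
      rw [hKR]; linarith
    refine h1.trans_lt ?_
    rw [div_lt_iff₀ (by positivity)]
    refine lt_of_mul_lt_mul_right ?_ hD0.le
    have h2 := mul_le_mul_of_nonneg_left hσD
      (show 0 ≤ 2 * ((t : ℝ) + 1) * (t + 2) by positivity)
    have h3 : 0 < 4 * (2 + q) * (t + 2) * D - 2 * ((t : ℝ) + 1) * (t + 2) * ((2 + q) * (2 + q + 1))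
        - (2 * (t + 1) * (2 + q) + t) * D := by
      rw [hD]; ring_nf; positivity
    linarith
  have hu0 : 0 ≤ (K : ℝ) * γ - t := by linarith
  have hu1 : 0 ≤ (t : ℝ) + 1 - K * γ := by linarith
  have e : 4 * ((2 + q) - K * γ * σ) = (t + 1 - K * γ) * (4 * ((2 + q) - t * σ)) +
      (K * γ - t) * (4 * ((2 + q) - (t + 1) * σ)) := by ring
  rw [e, sharedDelay]
  -- The weights sum to one, so at least one of them is positive and strictness survives.
  rcases hu0.eq_or_lt with h | h
  · rw [← h, zero_mul, zero_mul, add_zero, add_zero]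
    exact mul_lt_mul_of_pos_left hA (by linarith)
  · exact add_lt_add_of_le_of_lt (mul_le_mul_of_nonneg_left hA.le hu1)
      (mul_lt_mul_of_pos_left hB h)

theorem sharedDelay_lt_four_mul_optimalDelay {K N t : ℕ} {M γ : ℝ} (hNK : K ≤ N) (ht : t < K)
    (hγ : γ = M / (N : ℝ)) (hlo : (t : ℝ) ≤ (K : ℝ) * γ) (hhi : (K : ℝ) * γ ≤ (t : ℝ) + 1)
    (hγ1 : γ < 1) : sharedDelay K t γ < 4 * optimalDelay K N M := by
  have hK : 0 < K := by omega
  have hKR : (0 : ℝ) < K := by exact_mod_cast hK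
  have hN : 0 < N := hK.trans_le hNK
  have hNR : (0 : ℝ) < N := by exact_mod_cast hN
  have hM : M = N * γ := by rw [hγ]; field_simp
  have hγ0 : 0 ≤ γ := by
    have : 0 ≤ (K : ℝ) * γ := (Nat.cast_nonneg t).trans hlo
    exact nonneg_of_mul_nonneg_right this hKR
  obtain ⟨s, hs, hlt⟩ : ∃ s ≤ K, sharedDelay K t γ <
      4 * ((s : ℝ) - K * γ * (s * (s + 1) / (2 * (K + 1 - s)))) := by
    rcases lt_or_ge K (4 * (t + 1)) with h | h
    · exact ⟨1, hK, sharedDelay_lt_of_few_users ht hlo hγ1 h⟩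
    · refine ⟨K / (2 * (t + 1)), Nat.div_le_self _ _, sharedDelay_lt_of_many_users hlo hhi
        ?_ (Nat.mod_lt K (show 0 < 2 * (t + 1) by omega)) (Nat.div_add_mod _ _).symm⟩
      -- The threshold `4 * (t + 1)` is exactly what gives `s ≥ 2`.
      rw [Nat.le_div_iff_mul_le (by omega)]
      omega
  have hbound : ∑ i ∈ Finset.range s, (1 - ((i : ℝ) + 1) * M / ((N : ℝ) - i)) ≤
      optimalDelay K N M :=
    le_csInf ⟨_, (zeroErrorAchievable_sharedDelay K N t M γ hNK ht hγ hlo hhi).achievable⟩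
      fun T hT => Achievable.lower_bound hT hNK hN hs
  have := lower_bound_sum_ge hNK hs hM hγ0
  linarith

end CodedCaching

theorem proposition1 (K N t : ℕ) (M γ : ℝ) (hNK : K ≤ N) (ht : t < K) (hγ : γ = M / (N : ℝ))
    (hlo : (t : ℝ) ≤ (K : ℝ) * γ) (hhi : (K : ℝ) * γ ≤ (t : ℝ) + 1) :
    CodedCaching.sharedDelay K t γ =
        ((K : ℝ) - (t : ℝ)) / ((t : ℝ) + 1) -
          ((K : ℝ) * γ - (t : ℝ)) * ((K : ℝ) + 1) / (((t : ℝ) + 1) * ((t : ℝ) + 2)) ∧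
      CodedCaching.ZeroErrorAchievable K N M (CodedCaching.sharedDelay K t γ) ∧
      CodedCaching.Achievable K N M (CodedCaching.sharedDelay K t γ) ∧
      CodedCaching.sharedDelay K t γ ≤ 4 * CodedCaching.optimalDelay K N M ∧
      (γ < 1 → 0 < CodedCaching.optimalDelay K N M ∧
        CodedCaching.sharedDelay K t γ / CodedCaching.optimalDelay K N M < 4) := by
  have hzero := CodedCaching.zeroErrorAchievable_sharedDelay K N t M γ hNK ht hγ hlo hhi
  have hach := hzero.achievable
  have hlt := CodedCaching.sharedDelay_lt_four_mul_optimalDelay hNK ht hγ hlo hhi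
  refine ⟨CodedCaching.sharedDelay_eq K t γ, hzero, hach, ?_, fun hγ1 => ?_⟩
  · rcases lt_or_ge γ 1 with h | h
    · exact (hlt h).le
    -- Here `K * γ ≥ K ≥ t + 1 ≥ K * γ`, so the caches hold the whole library and the delay is zero.
    · have htK : (t : ℝ) + 1 ≤ K := by exact_mod_cast ht
      have hKγ : (K : ℝ) * γ = K := by nlinarith [(Nat.cast_nonneg t : (0 : ℝ) ≤ t)]
      have ht1 : (t : ℝ) + 1 = K := by linarith
      have h0 : CodedCaching.sharedDelay K t γ = 0 := by
        simp [CodedCaching.sharedDelay, hKγ, ht1]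
      have : 0 ≤ CodedCaching.optimalDelay K N M :=
        le_csInf ⟨_, hach⟩ fun T hT => CodedCaching.Achievable.nonneg hT
      linarith
  · have hpos : 0 < CodedCaching.optimalDelay K N M := by
      have := hlt hγ1
      have := hach.nonneg
      linarith
    exact ⟨hpos, (div_lt_iff₀ hpos).mpr (hlt hγ1)⟩
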